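/- Let $M$ be a hypercomplex manifold, that is, a $C^\infty$-manifold with integrable almost complex structures $I,J,K$ such that $I\circ J=-J\circ I=K$. A hypercomplex Hermitian metric on $M$ is a (smooth) Riemannian metric $g$ preserved by $I,J,K$. Put $\omega_J:=g(J\cdot,\cdot)$ and $\omega_K:=g(K\cdot,\cdot)$; the canonical $(2,0)$-form of $g$ is $$\Omega_g:=\tfrac12\bigl(\omega_J+\sqrt{-1}\,\omega_K\bigr),$$ which is of type $(2,0)$ on $(M,I)$. The metric $g$ is called HKT if $\partial(\omega_J+\sqrt{-1}\,\omega_K)=0$, where $\partial$ is the Dolbeault operator of $(M,I)$, and $M$ is called an HKT-manifold if it admits an HKT metric. Let $J$ act on forms multiplicatively; on 2-forms, $(J\eta)(x,y)=\eta(Jx,Jy)$. A $(2,0)$-form $\eta$ on $(M,I)$ is strictly $q$-positive if $\eta=J(\bar\eta)$ and $\eta(v,J\bar v)>0$ for every non-zero $v\in T^{1,0}_I(M)$, where $\eta$ and $J$ are extended complex-linearly to $TM\otimes\mathbb C$. Let $\Omega$ be a smooth strictly $q$-positive $(2,0)$-form on $(M,I)$ with $\partial\Omega=0$. Then $M$ is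 an HKT-manifold, and $\Omega=\Omega_h$ for an HKT metric $h$ on $M$. Moreover, $h$ is uniquely determined by $\Omega$: every hypercomplex Hermitian metric $h'$ with $\Omega_{h'}=\Omega$ equals $h$. -/

import Mathlib

open scoped Manifold ContDiff TensorProduct
open VectorField

noncomputable section

namespace HKT

/-! ### Linear algebra: complexification and types of complex-valued forms -/

section LinearAlgebra

variable {V : Type*} [AddCommGroup V] [Module ℝ V]

/-- The real part `ℂ ⊗ V → V`, `z ⊗ v ↦ (Re z) v`. -/
def rePart : ℂ ⊗[ℝ] V →ₗ[ℝ] V :=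
  (TensorProduct.lid ℝ V).toLinearMap ∘ₗ TensorProduct.map Complex.reLm LinearMap.id

/-- The imaginary part `ℂ ⊗ V → V`, `z ⊗ v ↦ (Im z) v`. -/
def imPart : ℂ ⊗[ℝ] V →ₗ[ℝ] V :=
  (TensorProduct.lid ℝ V).toLinearMap ∘ₗ TensorProduct.map Complex.imLm LinearMap.id

/-- Complex conjugation `z ⊗ v ↦ z̄ ⊗ v` of the complexification. -/
def conjC : ℂ ⊗[ℝ] V →ₗ[ℝ] ℂ ⊗[ℝ] V :=
  TensorProduct.map Complex.conjAe.toLinearMap LinearMap.id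

/-- The space `V^{1,0}`: the `√-1`-eigenspace of (the complex-linear extension of) `A`. -/
def type10 (A : V →ₗ[ℝ] V) : Submodule ℂ (ℂ ⊗[ℝ] V) :=
  Module.End.eigenspace (A.baseChange ℂ) Complex.I

/-- The space `V^{0,1}`: the `-√-1`-eigenspace of (the complex-linear extension of) `A`. -/
def type01 (A : V →ₗ[ℝ] V) : Submodule ℂ (ℂ ⊗[ℝ] V) :=
  Module.End.eigenspace (A.baseChange ℂ) (-Complex.I)

/-- The `(1,0)`-part `(v - √-1 A v) / 2` of a real vector. -/
def proj10 (A : V →ₗ[ℝ] V) : V →ₗ[ℝ] ℂ ⊗[ℝ] V :=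
  TensorProduct.mk ℝ ℂ V (1 / 2) - (TensorProduct.mk ℝ ℂ V (Complex.I / 2)) ∘ₗ A

/-- The `(0,1)`-part `(v + √-1 A v) / 2` of a real vector. -/
def proj01 (A : V →ₗ[ℝ] V) : V →ₗ[ℝ] ℂ ⊗[ℝ] V :=
  TensorProduct.mk ℝ ℂ V (1 / 2) + (TensorProduct.mk ℝ ℂ V (Complex.I / 2)) ∘ₗ A

variable {k : ℕ}

/-- If `α` is skew under all permutations, so is the sum, over all sets `S` of slots in a
family weighted by cardinality, of `α` with `f` inserted in the slots of `S` and `g` in the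
others. -/
theorem sum_slots_perm {W W' : Type*} [AddCommGroup W] [Module ℝ W] [AddCommGroup W'] [Module ℝ W']
    (α : MultilinearMap ℝ (fun _ : Fin k => W') ℂ)
    (hα : ∀ (σ : Equiv.Perm (Fin k)) (w : Fin k → W'),
      α (w ∘ σ) = (Equiv.Perm.sign σ : ℤ) • α w)
    (f g : W →ₗ[ℝ] W') (c : ℕ → ℂ) (σ : Equiv.Perm (Fin k)) (w : Fin k → W) :
    (∑ S : Finset (Fin k), c S.card •
        α.compLinearMap (fun j => if j ∈ S then f else g)) (w ∘ σ)
      = (Equiv.Perm.sign σ : ℤ) • (∑ S : Finset (Fin k), c S.card •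
        α.compLinearMap (fun j => if j ∈ S then f else g)) w := by
  simp only [sum_apply, smul_apply,
    MultilinearMap.compLinearMap_apply, Finset.smul_sum]
  refine Fintype.sum_equiv (σ.finsetCongr) _ _ fun S => ?_
  have h := hα σ (fun j => (if j ∈ σ.finsetCongr S then f else g) (w j))
  have h2 : ((fun j => (if j ∈ σ.finsetCongr S then f else g) (w j)) ∘ σ)
      = fun j => (if j ∈ S then f else g) ((w ∘ σ) j) := by
    funext j
    simp [Equiv.finsetCongr]
  rw [h2] at h
  rw [h, smul_comm]
  simp [Equiv.finsetCongr]

/-- A multilinear map that is skew under all permutations, as an alternating map. -/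
def altOfSkew {W : Type*} [AddCommGroup W] [Module ℝ W]
    (α : MultilinearMap ℝ (fun _ : Fin k => W) ℂ)
    (hα : ∀ (σ : Equiv.Perm (Fin k)) (w : Fin k → W),
      α (w ∘ σ) = (Equiv.Perm.sign σ : ℤ) • α w) : W [⋀^Fin k]→ₗ[ℝ] ℂ :=
  { α with
    map_eq_zero_of_eq' := by
      intro v i j hv hij
      have h := hα (Equiv.swap i j) v
      have h2 : v ∘ Equiv.swap i j = v := by
        funext l
        simp only [Function.comp_apply, Equiv.swap_apply_def]
        split_ifs with h3 h4
        · rw [h3, hv]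
        · rw [h4, hv]
        · rfl
      rw [h2, Equiv.Perm.sign_swap hij] at h
      have h3 : α v = - α v := by simpa using h
      exact self_eq_neg.mp h3 }

/-- The complex-multilinear extension of a complex-valued real alternating form `α` to the
complexification: expanding `α (x₁ + √-1 y₁, …, x_k + √-1 y_k)`, one gets the sum over all
sets `S` of slots of `(√-1)^|S|` times `α` evaluated on `y_j` in the slots of `S` and on `x_j`
in the others. -/
def complexExt (α : V [⋀^Fin k]→ₗ[ℝ] ℂ) : (ℂ ⊗[ℝ] V) [⋀^Fin k]→ₗ[ℝ] ℂ :=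
  altOfSkew
    (∑ S : Finset (Fin k), Complex.I ^ S.card •
      α.toMultilinearMap.compLinearMap (fun j => if j ∈ S then imPart else rePart))
    (sum_slots_perm _ (fun σ w => (α.map_perm w σ).trans (Units.smul_def _ _)) _ _ (fun n => Complex.I ^ n))

/-- The value of the extension on pure tensors. It shows that `complexExt` is the
complex-multilinear extension. -/
theorem complexExt_tmul (α : V [⋀^Fin k]→ₗ[ℝ] ℂ) (z : Fin k → ℂ) (v : Fin k → V) :
    complexExt α (fun j => z j ⊗ₜ[ℝ] v j) = (∏ j, z j) * α v := by
  classical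
  have hz : ∏ j, z j = ∏ j, ((z j).im * Complex.I + (z j).re) := by
    refine Finset.prod_congr rfl fun j _ => ?_
    rw [add_comm, Complex.re_add_im]
  rw [hz, Finset.prod_add, Finset.powerset_univ, Finset.sum_mul]
  change (∑ S : Finset (Fin k), Complex.I ^ S.card •
      α.toMultilinearMap.compLinearMap (fun j => if j ∈ S then imPart else rePart)) _ = _
  simp only [sum_apply, smul_apply,
    MultilinearMap.compLinearMap_apply]
  refine Finset.sum_congr rfl fun S _ => ?_
  have h : (fun j => (if j ∈ S then imPart else rePart) (z j ⊗ₜ[ℝ] v j))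
      = fun j => (if j ∈ S then (z j).im else (z j).re) • v j := by
    funext j
    split_ifs <;> simp [imPart, rePart]
  rw [h, MultilinearMap.map_smul_univ, Finset.prod_mul_distrib, Finset.prod_const,
    ← Finset.prod_mul_prod_compl S]
  have h1 : ∏ j ∈ S, (if j ∈ S then (z j).im else (z j).re) = ∏ j ∈ S, (z j).im :=
    Finset.prod_congr rfl fun j hj => by simp [hj]
  have h2 : ∏ j ∈ Sᶜ, (if j ∈ S then (z j).im else (z j).re) = ∏ j ∈ Sᶜ, (z j).re :=
    Finset.prod_congr rfl fun j hj => by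
      have : j ∉ S := by simpa using hj
      simp [this]
  rw [h1, h2, ← Finset.compl_eq_univ_sdiff]
  simp only [Complex.real_smul, smul_eq_mul, AlternatingMap.coe_multilinearMap]
  push_cast
  ring

/-- `α` is of type `(p,q)` with respect to `A`: it has degree `p + q`, and its extension
vanishes on `(1,0)`- and `(0,1)`-vectors unless exactly `p` of them are `(1,0)`-vectors. -/
def IsOfType (A : V →ₗ[ℝ] V) (p q : ℕ) (α : V [⋀^Fin k]→ₗ[ℝ] ℂ) : Prop :=
  p + q = k ∧ ∀ (S : Finset (Fin k)) (w : Fin k → ℂ ⊗[ℝ] V), S.card ≠ p →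
    (∀ j ∈ S, w j ∈ type10 A) → (∀ j ∉ S, w j ∈ type01 A) → complexExt α w = 0

/-- The component of type `(p, k - p)` of a `k`-form `α`: the sum over all sets `S` of `p`
slots of the extension of `α` evaluated on the `(1,0)`-parts of the arguments in the slots
of `S` and on the `(0,1)`-parts of the others. -/
def typePart (A : V →ₗ[ℝ] V) (p : ℕ) (α : V [⋀^Fin k]→ₗ[ℝ] ℂ) : V [⋀^Fin k]→ₗ[ℝ] ℂ :=
  altOfSkew
    (∑ S : Finset (Fin k), (if S.card = p then (1 : ℂ) else 0) •
      (complexExt α).toMultilinearMap.compLinearMap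
        (fun j => if j ∈ S then proj10 A else proj01 A))
    (sum_slots_perm _ (fun σ w => ((complexExt α).map_perm w σ).trans (Units.smul_def _ _)) _ _
      (fun n => if n = p then (1 : ℂ) else 0))

end LinearAlgebra

/-! ### Complex-valued differential forms on a manifold -/

section Forms

variable (E : Type*) [NormedAddCommGroup E] [NormedSpace ℝ E]
  (M : Type*) [TopologicalSpace M] [ChartedSpace E M]

/-- Complex-valued differential `k`-forms (not necessarily smooth). -/
abbrev ComplexForm (k : ℕ) : Type _ :=
  ∀ x : M, TangentSpace 𝓘(ℝ, E) x [⋀^Fin k]→L[ℝ] ℂ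

variable {E M} {k : ℕ}

/-- The expression of a form in the chart at `x₀`, that is, its pullback under the inverse of
this chart. It is meaningful on the target of the chart, an open set of `E`. -/
def chartForm (η : ComplexForm E M k) (x₀ : M) (y : E) : E [⋀^Fin k]→L[ℝ] ℂ :=
  (η ((extChartAt 𝓘(ℝ, E) x₀).symm y)).compContinuousLinearMap
    (mfderiv 𝓘(ℝ, E) 𝓘(ℝ, E) (extChartAt 𝓘(ℝ, E) x₀).symm y)

/-- A form is smooth if its expressions in charts are. -/
def IsSmoothForm (η : ComplexForm E M k) : Prop :=
  ∀ x₀ : M, ContDiffOn ℝ ∞ (chartForm η x₀) (extChartAt 𝓘(ℝ, E) x₀).target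

/-- The exterior derivative, computed at each point in the chart at this point. -/
def extD (η : ComplexForm E M k) : ComplexForm E M (k + 1) := fun x =>
  (extDeriv (chartForm η x) (extChartAt 𝓘(ℝ, E) x x)).compContinuousLinearMap
    (mfderiv 𝓘(ℝ, E) 𝓘(ℝ, E) (extChartAt 𝓘(ℝ, E) x) x)

/-- A smooth field of endomorphisms of the tangent bundle. -/
abbrev EndField (E : Type*) [NormedAddCommGroup E] [NormedSpace ℝ E]
    (M : Type*) [TopologicalSpace M] [ChartedSpace E M] [IsManifold 𝓘(ℝ, E) ∞ M] : Type _ :=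
  ContMDiffSection 𝓘(ℝ, E) (E →L[ℝ] E) ∞
    (fun x : M => TangentSpace 𝓘(ℝ, E) x →L[ℝ] TangentSpace 𝓘(ℝ, E) x)

variable [IsManifold 𝓘(ℝ, E) ∞ M]

/-- The Dolbeault operator `∂ : Λ^{p,k-p} → Λ^{p+1,k-p}` of an integrable complex structure
`A`, on forms `η` of type `(p, k - p)`: the `(p+1, k-p)`-component of `dη`. -/
def dolbeault (A : EndField E M) (p : ℕ) (η : ComplexForm E M k) :
    ∀ x : M, TangentSpace 𝓘(ℝ, E) x [⋀^Fin (k + 1)]→ₗ[ℝ] ℂ := fun x =>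
  typePart (A x).toLinearMap (p + 1) (extD η x).toAlternatingMap

/-- `A` is an almost complex structure. -/
def IsAlmostComplex (A : EndField E M) : Prop :=
  ∀ (x : M) (v : TangentSpace 𝓘(ℝ, E) x), A x (A x v) = -v

/-- Integrability of an almost complex structure: the Nijenhuis tensor
`[X,Y] + A[AX,Y] + A[X,AY] - [AX,AY]` vanishes. -/
def IsIntegrable (A : EndField E M) : Prop :=
  ∀ (x : M) (X Y : ∀ y : M, TangentSpace 𝓘(ℝ, E) y),
    ContMDiffAt 𝓘(ℝ, E) 𝓘(ℝ, E).tangent ∞ (fun y => (⟨y, X y⟩ : TangentBundle 𝓘(ℝ, E) M)) x →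
    ContMDiffAt 𝓘(ℝ, E) 𝓘(ℝ, E).tangent ∞ (fun y => (⟨y, Y y⟩ : TangentBundle 𝓘(ℝ, E) M)) x →
    mlieBracket 𝓘(ℝ, E) X Y x
      + A x (mlieBracket 𝓘(ℝ, E) (fun y => A y (X y)) Y x)
      + A x (mlieBracket 𝓘(ℝ, E) X (fun y => A y (Y y)) x)
      - mlieBracket 𝓘(ℝ, E) (fun y => A y (X y)) (fun y => A y (Y y)) x = 0

end Forms

/-! ### Hypercomplex manifolds, hypercomplex Hermitian metrics and HKT metrics -/

section Hypercomplex

variable (E : Type*) [NormedAddCommGroup E] [NormedSpace ℝ E]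
  (M : Type*) [TopologicalSpace M] [ChartedSpace E M] [IsManifold 𝓘(ℝ, E) ∞ M]

/-- A hypercomplex structure on `M`: integrable almost complex structures `I`, `J`, `K` with
`I ∘ J = - J ∘ I = K`. -/
structure HypercomplexStructure where
  I : EndField E M
  J : EndField E M
  K : EndField E M
  I_almostComplex : IsAlmostComplex I
  J_almostComplex : IsAlmostComplex J
  K_almostComplex : IsAlmostComplex K
  I_J : ∀ (x : M) (v : TangentSpace 𝓘(ℝ, E) x), I x (J x v) = K x v
  J_I : ∀ (x : M) (v : TangentSpace 𝓘(ℝ, E) x), J x (I x v) = -K x v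
  I_integrable : IsIntegrable I
  J_integrable : IsIntegrable J
  K_integrable : IsIntegrable K

variable {E M}

/-- A hypercomplex Hermitian metric: a smooth Riemannian metric preserved by `I`, `J`, `K`. -/
@[ext]
structure HermitianMetric (H : HypercomplexStructure E M) where
  metric : Bundle.ContMDiffRiemannianMetric 𝓘(ℝ, E) ∞ E
    (fun x : M => TangentSpace 𝓘(ℝ, E) x)
  inner_I : ∀ (x : M) (v w : TangentSpace 𝓘(ℝ, E) x),
    metric.inner x (H.I x v) (H.I x w) = metric.inner x v w
  inner_J : ∀ (x : M) (v w : TangentSpace 𝓘(ℝ, E) x),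
    metric.inner x (H.J x v) (H.J x w) = metric.inner x v w
  inner_K : ∀ (x : M) (v w : TangentSpace 𝓘(ℝ, E) x),
    metric.inner x (H.K x v) (H.K x w) = metric.inner x v w

variable {H : HypercomplexStructure E M}

/-- The fundamental 2-form `ω_A (v, w) = g (A v, w)` of an almost complex structure `A`
preserving the Riemannian metric `g`. -/
def fundamentalForm
    (g : Bundle.ContMDiffRiemannianMetric 𝓘(ℝ, E) ∞ E (fun x : M => TangentSpace 𝓘(ℝ, E) x))
    (A : EndField E M) (hA : IsAlmostComplex A)
    (hg : ∀ (x : M) (v w : TangentSpace 𝓘(ℝ, E) x), g.inner x (A x v) (A x w) = g.inner x v w)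
    (x : M) : TangentSpace 𝓘(ℝ, E) x [⋀^Fin 2]→L[ℝ] ℝ where
  toFun v := g.inner x (A x (v 0)) (v 1)
  map_update_add' := by
    intro _ v i a b
    fin_cases i <;> simp
  map_update_smul' := by
    intro _ v i c a
    fin_cases i <;> simp
  map_eq_zero_of_eq' := by
    intro v i j hv hij
    have hskew : ∀ u : TangentSpace 𝓘(ℝ, E) x, g.inner x (A x u) u = 0 := by
      intro u
      have h := hg x (A x u) u
      rw [hA x u, map_neg, neg_apply, g.symm x u (A x u)] at h
      linarith
    have h01 : v 0 = v 1 := by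
      fin_cases i <;> fin_cases j <;> simp_all
    rw [h01]
    exact hskew (v 1)
  cont := by
    have h : ∀ (B : E →L[ℝ] E →L[ℝ] ℝ) (L : E →L[ℝ] E),
        Continuous fun v : Fin 2 → E => B (L (v 0)) (v 1) := by
      intro B L
      fun_prop
    exact h (g.inner x) (A x)

/-- A real-valued alternating form as a complex-valued one. -/
def toComplexForm {k : ℕ} {x : M} (α : TangentSpace 𝓘(ℝ, E) x [⋀^Fin k]→L[ℝ] ℝ) :
    TangentSpace 𝓘(ℝ, E) x [⋀^Fin k]→L[ℝ] ℂ :=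
  Complex.ofRealCLM.compContinuousAlternatingMap α

/-- The form `ω_J + √-1 ω_K`. It is of type `(2,0)` with respect to `I`. -/
def HermitianMetric.omegaJK (h : HermitianMetric H) : ComplexForm E M 2 := fun x =>
  toComplexForm (fundamentalForm h.metric H.J H.J_almostComplex h.inner_J x)
    + Complex.I • toComplexForm (fundamentalForm h.metric H.K H.K_almostComplex h.inner_K x)

/-- The canonical (2,0)-form `½ (ω_J + √-1 ω_K)`. -/
def HermitianMetric.canonicalForm (h : HermitianMetric H) : ComplexForm E M 2 := fun x =>
  (1 / 2 : ℂ) • h.omegaJK x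

/-- `h` is an HKT metric: `∂ (ω_J + √-1 ω_K) = 0`, where `∂` is taken on `(M, I)`. -/
def HermitianMetric.IsHKT (h : HermitianMetric H) : Prop :=
  dolbeault H.I 2 h.omegaJK = 0

/-- A hypercomplex manifold is an HKT-manifold if it admits an HKT metric. -/
def HypercomplexStructure.IsHKTManifold (H : HypercomplexStructure E M) : Prop :=
  ∃ h : HermitianMetric H, h.IsHKT

/-- The complex conjugate of a form. -/
def conjForm {k : ℕ} {x : M} (α : TangentSpace 𝓘(ℝ, E) x [⋀^Fin k]→L[ℝ] ℂ) :
    TangentSpace 𝓘(ℝ, E) x [⋀^Fin k]→L[ℝ] ℂ :=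
  Complex.conjCLE.toContinuousLinearMap.compContinuousAlternatingMap α

/-- A form of type `(2,0)` on `(M, I)`. -/
def HypercomplexStructure.IsTwoZeroForm (H : HypercomplexStructure E M)
    (η : ComplexForm E M 2) : Prop :=
  ∀ x, IsOfType (H.I x).toLinearMap 2 0 (η x).toAlternatingMap

/-- A `(2,0)`-form is `q`-real if `η = J(η̄)`, where `J` acts on forms multiplicatively,
that is, on 2-forms, by `(J α)(v, w) = α (J v, J w)`. -/
def HypercomplexStructure.IsQReal (H : HypercomplexStructure E M)
    (η : ComplexForm E M 2) : Prop :=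
  ∀ x, (conjForm (η x)).compContinuousLinearMap (H.J x) = η x

/-- A `(2,0)`-form is strictly `q`-positive if it is `q`-real and `η (v, J v̄) > 0` (a positive
real number) for all non-zero `v ∈ T^{1,0}_I M`. -/
def HypercomplexStructure.IsStrictlyQPositive (H : HypercomplexStructure E M)
    (η : ComplexForm E M 2) : Prop :=
  H.IsQReal η ∧ ∀ (x : M) (v : ℂ ⊗[ℝ] TangentSpace 𝓘(ℝ, E) x),
    v ∈ type10 (H.I x).toLinearMap → v ≠ 0 →
      ∃ r : ℝ, 0 < r ∧ complexExt (η x).toAlternatingMap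
        ![v, (H.J x).toLinearMap.baseChange ℂ (conjC v)] = (r : ℂ)

end Hypercomplex

end HKT

end

noncomputable section

namespace HKT

/-! ### Real 2-forms of type (2,0) and their complex extension -/

section LinearAlgebra

variable {V : Type*} [AddCommGroup V] [Module ℝ V]

/-! The real part of `Ω_h` is `½ h(J·,·)`, so `J² = -1` forces `h(v,w) = -2 Re Ω(Jv,w)`; this gives
uniqueness and also the candidate metric `bilinOfForm`. Symmetry and `J`-invariance come from
q-reality, `I`-invariance from type (2,0) with `JI = -IJ`, and `K`-invariance from `K = IJ`.
Positivity holds because `Ω(v, Jv)` is the value of the Hermitian form of `Ω` on the (1,0)-part of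
`v` (`IsOfType.complexExt_proj10`). Smoothness is read off in a chart (`contMDiff_bilinOfForm`).
Finally `JK = I` and complex linearity give `ω_J + √-1 ω_K = 2Ω` (`omegaJK_ofForm`), so linearity of
`∂` turns `∂Ω = 0` into the HKT condition. -/

theorem alternating_swap {W N : Type*} [AddCommGroup W] [Module ℝ W] [AddCommGroup N] [Module ℝ N]
    (f : W [⋀^Fin 2]→ₗ[ℝ] N) (a b : W) : f ![a, b] = -f ![b, a] := by
  have h := f.map_swap ![b, a] (i := 0) (j := 1) (by simp)
  rw [← h]
  congr 1
  ext i
  fin_cases i <;> simp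

theorem alternating_add_left {W N : Type*} [AddCommGroup W] [Module ℝ W] [AddCommGroup N]
    [Module ℝ N] (f : W [⋀^Fin 2]→ₗ[ℝ] N) (a b c : W) :
    f ![a + b, c] = f ![a, c] + f ![b, c] :=
  f.map_vecCons_add ![c] a b

theorem alternating_add_right {W N : Type*} [AddCommGroup W] [Module ℝ W] [AddCommGroup N]
    [Module ℝ N] (f : W [⋀^Fin 2]→ₗ[ℝ] N) (a b c : W) :
    f ![c, a + b] = f ![c, a] + f ![c, b] := by
  rw [alternating_swap, alternating_add_left, neg_add, ← alternating_swap, ← alternating_swap]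

theorem alternating_smul_left {W N : Type*} [AddCommGroup W] [Module ℝ W] [AddCommGroup N]
    [Module ℝ N] (f : W [⋀^Fin 2]→ₗ[ℝ] N) (r : ℝ) (a c : W) :
    f ![r • a, c] = r • f ![a, c] :=
  f.map_vecCons_smul ![c] r a

theorem alternating_smul_right {W N : Type*} [AddCommGroup W] [Module ℝ W] [AddCommGroup N]
    [Module ℝ N] (f : W [⋀^Fin 2]→ₗ[ℝ] N) (r : ℝ) (a c : W) :
    f ![c, r • a] = r • f ![c, a] := by
  rw [alternating_swap, alternating_smul_left, alternating_swap, smul_neg, neg_neg]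

theorem alternating_neg_left {W N : Type*} [AddCommGroup W] [Module ℝ W] [AddCommGroup N]
    [Module ℝ N] (f : W [⋀^Fin 2]→ₗ[ℝ] N) (a c : W) :
    f ![-a, c] = -f ![a, c] := by
  simpa using alternating_smul_left f (-1) a c

theorem alternating_neg_right {W N : Type*} [AddCommGroup W] [Module ℝ W] [AddCommGroup N]
    [Module ℝ N] (f : W [⋀^Fin 2]→ₗ[ℝ] N) (a c : W) :
    f ![c, -a] = -f ![c, a] := by
  simpa using alternating_smul_right f (-1) a c

theorem complexExt_tmul_pair (α : V [⋀^Fin 2]→ₗ[ℝ] ℂ) (a b : ℂ) (v w : V) :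
    complexExt α ![a ⊗ₜ[ℝ] v, b ⊗ₜ[ℝ] w] = a * b * α ![v, w] := by
  have h := complexExt_tmul α ![a, b] ![v, w]
  rw [Fin.prod_univ_two] at h
  refine Eq.trans (congrArg _ ?_) h
  ext i
  fin_cases i <;> rfl

theorem proj10_eq (A : V →ₗ[ℝ] V) (v : V) :
    proj10 A v = (1 / 2 : ℂ) ⊗ₜ[ℝ] v + (-(Complex.I / 2)) ⊗ₜ[ℝ] A v := by
  rw [TensorProduct.neg_tmul, ← sub_eq_add_neg]
  rfl

theorem proj01_eq (A : V →ₗ[ℝ] V) (v : V) :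
    proj01 A v = (1 / 2 : ℂ) ⊗ₜ[ℝ] v + (Complex.I / 2) ⊗ₜ[ℝ] A v :=
  rfl

theorem proj10_add_proj01 (A : V →ₗ[ℝ] V) (v : V) :
    proj10 A v + proj01 A v = (1 : ℂ) ⊗ₜ[ℝ] v := by
  rw [proj10_eq, proj01_eq, TensorProduct.neg_tmul, add_add_add_comm, neg_add_cancel, add_zero,
    ← TensorProduct.add_tmul]
  norm_num

theorem proj10_mem {A : V →ₗ[ℝ] V} (hA : ∀ v, A (A v) = -v) (v : V) :
    proj10 A v ∈ type10 A := by
  rw [type10, Module.End.mem_eigenspace_iff, proj10_eq, map_add, LinearMap.baseChange_tmul,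
    LinearMap.baseChange_tmul, hA, smul_add, TensorProduct.smul_tmul', TensorProduct.smul_tmul',
    add_comm, TensorProduct.tmul_neg, TensorProduct.neg_tmul, neg_neg]
  congr 2 <;> simp [← mul_assoc, div_eq_mul_inv]

theorem proj01_mem {A : V →ₗ[ℝ] V} (hA : ∀ v, A (A v) = -v) (v : V) :
    proj01 A v ∈ type01 A := by
  rw [type01, Module.End.mem_eigenspace_iff, proj01_eq, map_add, LinearMap.baseChange_tmul,
    LinearMap.baseChange_tmul, hA, smul_add, TensorProduct.smul_tmul', TensorProduct.smul_tmul',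
    add_comm, TensorProduct.tmul_neg, ← TensorProduct.neg_tmul]
  congr 2 <;> simp [← mul_assoc, div_eq_mul_inv]

theorem rePart_proj10 (A : V →ₗ[ℝ] V) (v : V) : rePart (proj10 A v) = (1 / 2 : ℝ) • v := by
  simp [proj10_eq, rePart]

/-- The real part of the (1,0)-part is `v / 2`, so `v` can be recovered. This allows strict
q-positivity to be tested on real vectors. -/
theorem proj10_ne_zero (A : V →ₗ[ℝ] V) {v : V} (hv : v ≠ 0) : proj10 A v ≠ 0 := by
  intro h
  have h2 := rePart_proj10 A v
  rw [h, map_zero] at h2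
  exact hv ((smul_eq_zero.mp h2.symm).resolve_left (by norm_num))

/-- A form of type `(2,0)` is complex linear in its first argument. -/
theorem IsOfType.apply_left {A : V →ₗ[ℝ] V} (hA : ∀ v, A (A v) = -v) {α : V [⋀^Fin 2]→ₗ[ℝ] ℂ}
    (h : IsOfType A 2 0 α) (v w : V) : α ![A v, w] = Complex.I * α ![v, w] := by
  have h0 : complexExt α ![proj01 A v, proj10 A w] = 0 := by
    refine h.2 {1} _ (by simp) ?_ ?_
    · simpa using proj10_mem hA w
    · intro j hj
      fin_cases j
      · simpa using proj01_mem hA v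
      · simp at hj
  have h1 : complexExt α ![proj01 A v, proj01 A w] = 0 := by
    refine h.2 ∅ _ (by simp) (by simp) ?_
    intro j _
    fin_cases j
    · simpa using proj01_mem hA v
    · simpa using proj01_mem hA w
  have h2 : complexExt α ![proj01 A v, (1 : ℂ) ⊗ₜ[ℝ] w] = 0 := by
    rw [← proj10_add_proj01 A w, alternating_add_right, h0, h1, add_zero]
  rw [proj01_eq, alternating_add_left, complexExt_tmul_pair, complexExt_tmul_pair] at h2
  -- `h2` reads `½ α(v,w) + (√-1/2) α(Av,w) = 0`; multiplying by `-2√-1` isolates `α(Av,w)`.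
  linear_combination (-2 * Complex.I) * h2 + α ![A v, w] * Complex.I_mul_I

theorem IsOfType.apply_right {A : V →ₗ[ℝ] V} (hA : ∀ v, A (A v) = -v) {α : V [⋀^Fin 2]→ₗ[ℝ] ℂ}
    (h : IsOfType A 2 0 α) (v w : V) : α ![v, A w] = Complex.I * α ![v, w] := by
  rw [alternating_swap, h.apply_left hA, alternating_swap α v w, mul_neg]

/-- On the `(1,0)`-part of a real vector `v`, the Hermitian form of `α` is `α (v, B v)`. -/
theorem IsOfType.complexExt_proj10 {A B : V →ₗ[ℝ] V} (hA : ∀ v, A (A v) = -v)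
    (hAB : ∀ v, B (A v) = -A (B v)) {α : V [⋀^Fin 2]→ₗ[ℝ] ℂ} (h : IsOfType A 2 0 α) (v : V) :
    complexExt α ![proj10 A v, B.baseChange ℂ (conjC (proj10 A v))] = α ![v, B v] := by
  have hc : B.baseChange ℂ (conjC (proj10 A v)) =
      (1 / 2 : ℂ) ⊗ₜ[ℝ] B v + (Complex.I / 2) ⊗ₜ[ℝ] (B (A v)) := by
    simp [proj10_eq, conjC, map_ofNat, neg_div]
  -- Each of the four terms of the expansion equals `¼ α(v, Bv)`.
  rw [hc, proj10_eq, alternating_add_left, alternating_add_right, alternating_add_right]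
  simp only [complexExt_tmul_pair, hAB, alternating_neg_right, h.apply_left hA, h.apply_right hA]
  linear_combination (-(3 / 4) * α ![v, B v] + (1 / 4) * Complex.I ^ 2 * α ![v, B v])
    * Complex.I_mul_I

theorem complexExt_smul {k : ℕ} (c : ℂ) (α : V [⋀^Fin k]→ₗ[ℝ] ℂ) (w : Fin k → ℂ ⊗[ℝ] V) :
    complexExt (c • α) w = c * complexExt α w := by
  simp only [complexExt, altOfSkew, AlternatingMap.coe_mk, sum_apply,
    smul_apply, MultilinearMap.compLinearMap_apply, AlternatingMap.coe_multilinearMap,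
    AlternatingMap.smul_apply, Finset.mul_sum, smul_eq_mul]
  exact Finset.sum_congr rfl fun S _ => mul_left_comm _ _ _

theorem typePart_smul {k : ℕ} (A : V →ₗ[ℝ] V) (p : ℕ) (c : ℂ) (α : V [⋀^Fin k]→ₗ[ℝ] ℂ) :
    typePart A p (c • α) = c • typePart A p α := by
  ext w
  simp only [typePart, altOfSkew, AlternatingMap.coe_mk, sum_apply,
    smul_apply, MultilinearMap.compLinearMap_apply, AlternatingMap.coe_multilinearMap,
    AlternatingMap.smul_apply, Finset.mul_sum, smul_eq_mul, complexExt_smul]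
  exact Finset.sum_congr rfl fun S _ => mul_left_comm _ _ _

end LinearAlgebra

/-! ### Positive definite bilinear forms and real parts of 2-forms -/

section Bilinear

variable {E : Type*} [NormedAddCommGroup E] [NormedSpace ℝ E] [FiniteDimensional ℝ E]

/-- A positive definite bilinear form on a finite-dimensional space has a bounded unit ball. -/
theorem isVonNBounded_of_posDef (B : E →L[ℝ] E →L[ℝ] ℝ) (hB : ∀ v, v ≠ 0 → 0 < B v v) :
    Bornology.IsVonNBounded ℝ {v : E | B v v < 1} := by
  obtain ⟨c, hc, hcB⟩ : ∃ c : ℝ, 0 < c ∧ ∀ v ∈ Metric.sphere (0 : E) 1, c ≤ B v v := by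
    -- The sphere is empty when `E = 0`, and any positive `c` then serves.
    rcases (Metric.sphere (0 : E) 1).eq_empty_or_nonempty with h | h
    · exact ⟨1, one_pos, by simp [h]⟩
    · obtain ⟨u, hu, hmin⟩ := (isCompact_sphere (0 : E) 1).exists_isMinOn h
        (f := fun v => B v v) (by fun_prop)
      exact ⟨B u u, hB u (ne_zero_of_mem_unit_sphere ⟨u, hu⟩), fun v hv => hmin hv⟩
  rw [NormedSpace.isVonNBounded_iff, isBounded_iff_forall_norm_le]
  -- Homogeneity gives `‖v‖² ≤ c⁻¹`, and `2‖v‖ ≤ 1 + ‖v‖²` then bounds `‖v‖` without a square root.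
  refine ⟨1 + c⁻¹, fun v (hv : B v v < 1) => ?_⟩
  rcases eq_or_ne v 0 with rfl | hv0
  · rw [norm_zero]; positivity
  have hn : 0 < ‖v‖ := norm_pos_iff.mpr hv0
  have h := hcB (‖v‖⁻¹ • v) (by simp [norm_smul, hn.ne'])
  simp only [map_smul, smul_apply, smul_eq_mul] at h
  have h2 : c * (‖v‖ * ‖v‖) ≤ B v v := by
    calc c * (‖v‖ * ‖v‖) ≤ (‖v‖⁻¹ * (‖v‖⁻¹ * B v v)) * (‖v‖ * ‖v‖) := by gcongr
      _ = B v v := by field_simp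
  have h3 : ‖v‖ * ‖v‖ ≤ c⁻¹ := by
    rw [← one_div, le_div_iff₀ hc]
    linarith
  nlinarith [sq_nonneg (‖v‖ - 1)]

/-- The real part of a complex-valued 2-form, as a continuous bilinear form. -/
def reBilin (α : E [⋀^Fin 2]→L[ℝ] ℂ) : E →L[ℝ] E →L[ℝ] ℝ :=
  LinearMap.toContinuousLinearMap (LinearMap.toContinuousLinearMap.toLinearMap ∘ₗ
    LinearMap.mk₂ ℝ (fun v w => (α ![v, w]).re)
      (fun a b c => by simpa using congrArg Complex.re (alternating_add_left α.toAlternatingMap a b c))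
      (fun r a c => by simpa using congrArg Complex.re (alternating_smul_left α.toAlternatingMap r a c))
      (fun c a b => by simpa using congrArg Complex.re (alternating_add_right α.toAlternatingMap a b c))
      (fun r c a => by simpa using congrArg Complex.re (alternating_smul_right α.toAlternatingMap r a c)))

/-- In finite dimension, smoothness of an operator-valued map can be tested on fixed vectors, and
evaluation on a fixed pair is continuous and linear in the form. -/
theorem contDiffOn_reBilin {F : Type*} [NormedAddCommGroup F] [NormedSpace ℝ F] {n : WithTop ℕ∞}
    {α : F → E [⋀^Fin 2]→L[ℝ] ℂ} {s : Set F} (hα : ContDiffOn ℝ n α s) :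
    ContDiffOn ℝ n (fun y => reBilin (α y)) s := by
  rw [contDiffOn_clm_apply]
  intro v
  rw [contDiffOn_clm_apply]
  intro w
  have h := (Complex.reCLM.comp
    (ContinuousAlternatingMap.apply ℝ E ℂ ![v, w])).contDiff (n := n) |>.comp_contDiffOn hα
  exact h

end Bilinear

/-! ### Real homogeneity of the Dolbeault operator -/

section Dolbeault

variable {E : Type*} [NormedAddCommGroup E] [NormedSpace ℝ E]
  {M : Type*} [TopologicalSpace M] [ChartedSpace E M]

theorem extD_smul {k : ℕ} (c : ℝ) (η : ComplexForm E M k) : extD (c • η) = c • extD η := by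
  funext x
  have h : chartForm (c • η) x = c • chartForm η x := rfl
  rw [extD, h, extDeriv_smul]
  rfl

variable [IsManifold 𝓘(ℝ, E) ∞ M]

theorem dolbeault_smul {k : ℕ} (A : EndField E M) (p : ℕ) (c : ℝ) (η : ComplexForm E M k) :
    dolbeault A p (c • η) = (c : ℂ) • dolbeault A p η := by
  funext x
  rw [Pi.smul_apply, dolbeault, extD_smul, dolbeault, ← typePart_smul]
  congr 1

end Dolbeault

/-! ### The candidate metric and its smoothness -/

section Metric

variable {E : Type*} [NormedAddCommGroup E] [NormedSpace ℝ E] [FiniteDimensional ℝ E]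
  {M : Type*} [TopologicalSpace M] [ChartedSpace E M] [IsManifold 𝓘(ℝ, E) ∞ M]

/-- The bilinear form `-2 Re Ω (J v, w)`. -/
def bilinOfForm (H : HypercomplexStructure E M) (Ω : ComplexForm E M 2) (x : M) :
    TangentSpace 𝓘(ℝ, E) x →L[ℝ] TangentSpace 𝓘(ℝ, E) x →L[ℝ] ℝ :=
  ContinuousLinearMap.comp (M₁ := E) (M₂ := E) (M₃ := E →L[ℝ] ℝ) (reBilin (E := E) (Ω x))
    ((-2 : ℝ) • H.J x : E →L[ℝ] E)

theorem bilinOfForm_apply (H : HypercomplexStructure E M) (Ω : ComplexForm E M 2) (x : M)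
    (v w : TangentSpace 𝓘(ℝ, E) x) :
    bilinOfForm H Ω x v w = -2 * (Ω x ![H.J x v, w]).re := by
  have h := congrArg Complex.re (alternating_smul_left (Ω x).toAlternatingMap (-2) (H.J x v) w)
  rw [Complex.smul_re] at h
  exact h

/-- In the trivialization at `x₀` the bilinear form becomes `-2` times the real part of the chart
expression of `Ω`, composed with the coordinate expression of `J`. Both factors are smooth. -/
theorem contMDiff_bilinOfForm (H : HypercomplexStructure E M) {Ω : ComplexForm E M 2}
    (hΩ : IsSmoothForm Ω) :
    ContMDiff 𝓘(ℝ, E) (𝓘(ℝ, E).prod 𝓘(ℝ, E →L[ℝ] E →L[ℝ] ℝ)) ∞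
      (fun x : M => Bundle.TotalSpace.mk' (E →L[ℝ] E →L[ℝ] ℝ)
        (E := fun x : M => TangentSpace 𝓘(ℝ, E) x →L[ℝ] TangentSpace 𝓘(ℝ, E) x →L[ℝ] ℝ)
        x (bilinOfForm H Ω x)) := by
  intro x₀
  rw [contMDiffAt_hom_bundle]
  refine ⟨contMDiffAt_id, ?_⟩
  have hJ := ((contMDiffAt_hom_bundle _).mp (H.J.contMDiff x₀)).2
  have hΦ : ContMDiffAt 𝓘(ℝ, E) 𝓘(ℝ, E →L[ℝ] E →L[ℝ] ℝ) ∞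
      (fun x : M => reBilin (chartForm Ω x₀ (extChartAt 𝓘(ℝ, E) x₀ x))) x₀ := by
    have h1 := (contDiffOn_reBilin (hΩ x₀)).contDiffAt
      ((isOpen_extChartAt_target x₀).mem_nhds (mem_extChartAt_target x₀))
    exact h1.contMDiffAt.comp x₀ contMDiffAt_extChartAt
  refine ((contMDiffAt_const (I := 𝓘(ℝ, E)) (I' := 𝓘(ℝ, ℝ)) (c := (-2 : ℝ))).smul (hΦ.clm_comp hJ)).congr_of_eventuallyEq ?_
  filter_upwards [(chartAt E x₀).open_source.mem_nhds (mem_chart_source E x₀)] with x hx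
  have hb : x ∈ (trivializationAt E (TangentSpace 𝓘(ℝ, E)) x₀).baseSet := hx
  -- The inverse trivialization is the derivative of the inverse chart, the same map by which
  -- `chartForm` pulls back.
  have hs := TangentBundle.symmL_trivializationAt (I := 𝓘(ℝ, E)) hx
  rw [modelWithCornersSelf_coe, Set.range_id, mfderivWithin_univ] at hs
  have hx' : (extChartAt 𝓘(ℝ, E) x₀).symm (extChartAt 𝓘(ℝ, E) x₀ x) = x :=
    (extChartAt 𝓘(ℝ, E) x₀).left_inv (by simpa using hx)
  -- All tangent spaces unfold to `E`, so the base point can be changed along `hx'` without a cast.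
  have hΩx : ∀ x', x' = x → (Ω x' : E [⋀^Fin 2]→L[ℝ] ℂ) = Ω x := by
    rintro _ rfl
    rfl
  have hc : ∀ a b : E, chartForm Ω x₀ (extChartAt 𝓘(ℝ, E) x₀ x) ![a, b] =
      Ω x ![(trivializationAt E (TangentSpace 𝓘(ℝ, E)) x₀).symmL ℝ x a,
        (trivializationAt E (TangentSpace 𝓘(ℝ, E)) x₀).symmL ℝ x b] := by
    intro a b
    rw [hs]
    refine (DFunLike.congr_fun (hΩx ((extChartAt 𝓘(ℝ, E) x₀).symm (extChartAt 𝓘(ℝ, E) x₀ x)) hx') _).trans (congrArg (Ω x) ?_)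
    ext i
    fin_cases i <;> rfl
  ext v w
  rw [inCoordinates_apply_eq₂ hb hb (by simp)]
  change _ = -2 * (chartForm Ω x₀ (extChartAt 𝓘(ℝ, E) x₀ x)
    ![(trivializationAt E (TangentSpace 𝓘(ℝ, E)) x₀).continuousLinearMapAt ℝ x
      (H.J x ((trivializationAt E (TangentSpace 𝓘(ℝ, E)) x₀).symmL ℝ x v)), w]).re
  rw [hc, Bundle.Trivialization.symmL_continuousLinearMapAt _ hb, bilinOfForm_apply,
    Bundle.Trivialization.symmL_apply _ hb, Bundle.Trivialization.symmL_apply _ hb]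
  simp

end Metric

/-! ### Pointwise identities for `Ω` and the quaternionic relations -/

section PointwiseIdentities

variable {E : Type*} [NormedAddCommGroup E] [NormedSpace ℝ E]
  {M : Type*} [TopologicalSpace M] [ChartedSpace E M] {Ω : ComplexForm E M 2}

theorem form_neg_left (x : M) (v w : TangentSpace 𝓘(ℝ, E) x) :
    Ω x ![-v, w] = -Ω x ![v, w] :=
  alternating_neg_left (Ω x).toAlternatingMap v w

theorem form_swap (x : M) (v w : TangentSpace 𝓘(ℝ, E) x) :
    Ω x ![v, w] = -Ω x ![w, v] :=
  alternating_swap (Ω x).toAlternatingMap v w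

variable [IsManifold 𝓘(ℝ, E) ∞ M] {H : HypercomplexStructure E M}

theorem HypercomplexStructure.IsTwoZeroForm.apply_I_left (h : H.IsTwoZeroForm Ω) (x : M)
    (v w : TangentSpace 𝓘(ℝ, E) x) : Ω x ![H.I x v, w] = Complex.I * Ω x ![v, w] :=
  (h x).apply_left (H.I_almostComplex x) v w

theorem HypercomplexStructure.IsTwoZeroForm.apply_I_right (h : H.IsTwoZeroForm Ω) (x : M)
    (v w : TangentSpace 𝓘(ℝ, E) x) : Ω x ![v, H.I x w] = Complex.I * Ω x ![v, w] :=
  (h x).apply_right (H.I_almostComplex x) v w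

/-- q-reality says that `Ω(Jv,Jw)` is the conjugate of `Ω(v,w)`, and conjugation preserves real
parts. -/
theorem HypercomplexStructure.IsQReal.re_apply (h : H.IsQReal Ω) (x : M)
    (v w : TangentSpace 𝓘(ℝ, E) x) : (Ω x ![H.J x v, H.J x w]).re = (Ω x ![v, w]).re := by
  have h1 : (starRingEnd ℂ) (Ω x (H.J x ∘ ![v, w])) = Ω x ![v, w] :=
    DFunLike.congr_fun (h x) ![v, w]
  have h2 : (H.J x ∘ ![v, w]) = ![H.J x v, H.J x w] := by
    ext i
    fin_cases i <;> rfl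
  rw [← h1, h2, Complex.conj_re]

theorem HypercomplexStructure.J_K (H : HypercomplexStructure E M) (x : M)
    (v : TangentSpace 𝓘(ℝ, E) x) : H.J x (H.K x v) = H.I x v := by
  rw [← H.I_J, H.J_I, ← H.I_J, H.J_almostComplex, map_neg, neg_neg]

theorem HermitianMetric.omegaJK_apply (h : HermitianMetric H) (x : M)
    (v : Fin 2 → TangentSpace 𝓘(ℝ, E) x) :
    h.omegaJK x v = (h.metric.inner x (H.J x (v 0)) (v 1) : ℂ)
      + Complex.I * (h.metric.inner x (H.K x (v 0)) (v 1) : ℂ) :=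
  rfl

theorem HermitianMetric.canonicalForm_eq (h : HermitianMetric H) (hΩ : h.omegaJK = (2 : ℝ) • Ω) :
    h.canonicalForm = Ω := by
  funext x
  rw [canonicalForm, hΩ]
  ext v
  change (1 / 2 : ℂ) * ((2 : ℝ) • Ω x v) = Ω x v
  rw [Complex.real_smul]
  push_cast
  ring

end PointwiseIdentities

/-! ### The metric of a q-positive form, and uniqueness -/

section MetricOfForm

variable {E : Type*} [NormedAddCommGroup E] [NormedSpace ℝ E] [FiniteDimensional ℝ E]
  {M : Type*} [TopologicalSpace M] [ChartedSpace E M] [IsManifold 𝓘(ℝ, E) ∞ M]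
  {H : HypercomplexStructure E M} {Ω : ComplexForm E M 2}

/-- `Re Ω(Jv,w) = Re Ω(J²v,Jw) = -Re Ω(v,Jw) = Re Ω(Jw,v)`. -/
theorem bilinOfForm_symm (hq : H.IsQReal Ω) (x : M) (v w : TangentSpace 𝓘(ℝ, E) x) :
    bilinOfForm H Ω x v w = bilinOfForm H Ω x w v := by
  rw [bilinOfForm_apply, bilinOfForm_apply, ← hq.re_apply x (H.J x v) w, H.J_almostComplex,
    form_neg_left, form_swap, neg_neg]

/-- The sign from `JI = -IJ` cancels the factor `(√-1)² = -1` produced by complex linearity in both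
slots. -/
theorem bilinOfForm_I (h : H.IsTwoZeroForm Ω) (x : M) (v w : TangentSpace 𝓘(ℝ, E) x) :
    bilinOfForm H Ω x (H.I x v) (H.I x w) = bilinOfForm H Ω x v w := by
  rw [bilinOfForm_apply, bilinOfForm_apply, H.J_I, ← H.I_J, form_neg_left, h.apply_I_left,
    h.apply_I_right, ← mul_assoc, Complex.I_mul_I, neg_one_mul, neg_neg]

theorem bilinOfForm_J (hq : H.IsQReal Ω) (x : M) (v w : TangentSpace 𝓘(ℝ, E) x) :
    bilinOfForm H Ω x (H.J x v) (H.J x w) = bilinOfForm H Ω x v w := by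
  rw [bilinOfForm_apply, bilinOfForm_apply, hq.re_apply]

theorem bilinOfForm_pos (h : H.IsTwoZeroForm Ω) (hpos : H.IsStrictlyQPositive Ω) (x : M)
    (v : TangentSpace 𝓘(ℝ, E) x) (hv : v ≠ 0) : 0 < bilinOfForm H Ω x v v := by
  obtain ⟨r, hr, hΩ⟩ := hpos.2 x (proj10 (H.I x).toLinearMap v)
    (proj10_mem (H.I_almostComplex x) v) (proj10_ne_zero _ hv)
  have h2 : Ω x ![v, H.J x v] = r := by
    rw [← hΩ]
    exact ((h x).complexExt_proj10 (B := (H.J x).toLinearMap) (H.I_almostComplex x)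
      (fun v => (H.J_I x v).trans (congrArg _ (H.I_J x v).symm)) v).symm
  rw [bilinOfForm_apply, form_swap, h2, Complex.neg_re, Complex.ofReal_re]
  linarith

variable (H Ω) in
/-- The hypercomplex Hermitian metric with a given strictly `q`-positive canonical form. -/
def HermitianMetric.ofForm (hsmooth : IsSmoothForm Ω) (htype : H.IsTwoZeroForm Ω)
    (hpos : H.IsStrictlyQPositive Ω) : HermitianMetric H where
  metric :=
    { inner := bilinOfForm H Ω
      symm := bilinOfForm_symm hpos.1
      pos := bilinOfForm_pos htype hpos
      isVonNBounded := fun x =>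
        isVonNBounded_of_posDef (E := E) (bilinOfForm H Ω x) (bilinOfForm_pos htype hpos x)
      contMDiff := contMDiff_bilinOfForm H hsmooth }
  inner_I := bilinOfForm_I htype
  inner_J := bilinOfForm_J hpos.1
  inner_K := fun x v w => by
    change bilinOfForm H Ω x _ _ = bilinOfForm H Ω x _ _
    rw [← H.I_J, ← H.I_J, bilinOfForm_I htype, bilinOfForm_J hpos.1]

/-- `J² = -1` gives `ω_J = 2 Re Ω`. Since `JK = I`, `ω_K(v,w) = -2 Re Ω(Iv,w) = -2 Re(√-1 Ω(v,w)) =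
2 Im Ω(v,w)`. -/
theorem HermitianMetric.omegaJK_ofForm (hsmooth : IsSmoothForm Ω) (htype : H.IsTwoZeroForm Ω)
    (hpos : H.IsStrictlyQPositive Ω) :
    (HermitianMetric.ofForm H Ω hsmooth htype hpos).omegaJK = (2 : ℝ) • Ω := by
  funext x
  ext v
  rw [omegaJK_apply]
  change ((bilinOfForm H Ω x (H.J x (v 0)) (v 1) : ℝ) : ℂ)
    + Complex.I * ((bilinOfForm H Ω x (H.K x (v 0)) (v 1) : ℝ) : ℂ) = (2 : ℝ) • Ω x v
  have hv : v = ![v 0, v 1] := by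
    ext i
    fin_cases i <;> rfl
  rw [bilinOfForm_apply, bilinOfForm_apply, H.J_almostComplex, H.J_K, form_neg_left,
    htype.apply_I_left, ← hv]
  apply Complex.ext <;> simp

/-- A hypercomplex Hermitian metric is determined by its canonical form. -/
theorem HermitianMetric.inner_eq (h : HermitianMetric H) (x : M)
    (v w : TangentSpace 𝓘(ℝ, E) x) :
    h.metric.inner x v w = bilinOfForm H h.canonicalForm x v w := by
  have h1 : h.canonicalForm x ![H.J x v, w] =
      (1 / 2 : ℂ) * ((h.metric.inner x (H.J x (H.J x v)) w : ℂ)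
      + Complex.I * (h.metric.inner x (H.K x (H.J x v)) w : ℂ)) := rfl
  rw [bilinOfForm_apply, h1, H.J_almostComplex, map_neg, neg_apply]
  simp

theorem HermitianMetric.eq_of_canonicalForm_eq {h h' : HermitianMetric H}
    (hh : h.canonicalForm = h'.canonicalForm) : h = h' := by
  have hi : h.metric.inner = h'.metric.inner := by
    funext x
    ext v w
    rw [inner_eq, inner_eq, hh]
  -- All fields other than `inner` are proofs, so equality of the inner products suffices.
  obtain ⟨⟨g, _, _, _, _⟩, _, _, _⟩ := h
  obtain ⟨⟨g', _, _, _, _⟩, _, _, _⟩ := h'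
  obtain rfl : g = g' := hi
  rfl

end MetricOfForm

end HKT

end

theorem corollary3p3 {E : Type*} [NormedAddCommGroup E] [NormedSpace ℝ E] [FiniteDimensional ℝ E]
    {M : Type*} [TopologicalSpace M] [ChartedSpace E M] [IsManifold 𝓘(ℝ, E) ∞ M]
    (H : HKT.HypercomplexStructure E M) (Ω : HKT.ComplexForm E M 2)
    (hsmooth : HKT.IsSmoothForm Ω) (htype : H.IsTwoZeroForm Ω)
    (hclosed : HKT.dolbeault H.I 2 Ω = 0) (hpos : H.IsStrictlyQPositive Ω) :
    H.IsHKTManifold ∧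
      ∃ h : HKT.HermitianMetric H, h.IsHKT ∧ h.canonicalForm = Ω ∧
        ∀ h' : HKT.HermitianMetric H, h'.canonicalForm = Ω → h' = h := by
  have hΩ := HKT.HermitianMetric.omegaJK_ofForm hsmooth htype hpos
  have hcan := HKT.HermitianMetric.canonicalForm_eq _ hΩ
  have hHKT : (HKT.HermitianMetric.ofForm H Ω hsmooth htype hpos).IsHKT := by
    rw [HKT.HermitianMetric.IsHKT, hΩ, HKT.dolbeault_smul, hclosed, smul_zero]
  exact ⟨⟨_, hHKT⟩, _, hHKT, hcan, fun h' hh' =>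
    HKT.HermitianMetric.eq_of_canonicalForm_eq (hh'.trans hcan.symm)⟩
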